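/- Let $T^\infty$ be the triangular tiling graph: its vertices are the points $x(1,0)+y(\tfrac12,\tfrac{\sqrt3}{2})$ with $x,y\in\mathbb Z$, two of them being adjacent iff their Euclidean distance is $1$; its triangular faces are called cells. A triangular grid graph is a finite subgraph $G$ of $T^\infty$ formed by all edges bounding finitely many cells. A cell belongs to $G$ if all its edges are edges of $G$. An edge of $G$ is a boundary edge if it is also an edge of a cell of $T^\infty$ that does not belong to $G$. A cell of $G$ is a boundary cell if it has at least one boundary edge, and an interior cell otherwise. Subdividing a set $S$ of cells of $G$ means adding, for each cell in $S$, a new vertex adjacent exactly to the three vertices of that cell. A graph $H=(V,E)$ is word-representable if there is a word $w$ over the alphabet $V$ such that, for all $x\neq y$ in $V$, the letters $x$ and $y$ alternate in $w$ (that is, deleting all other letters from $w$ leaves $xyxy\cdots$ or $yxyx\cdots$) if and only if $xy\in E$. A set $S$ of cells of $G$ gives a maximal word-representable subdivision of $G$ if subdividing $S$ yields a word-representable graph, but subdividing any other cell of $G$ in addition yields a non-word-representable graph; if there is exactly one such $S$, the resulting graph is called the maximum subdivision of $G$. For an integer $n\ge 0$ let $T_n$ be the triangular grid graph formed by all cells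 contained in an equilateral triangle of side length $n$ whose corners are vertices of $T^\infty$ and whose sides lie along lines of $T^\infty$ ($T_0$ is the empty graph), and let $A_n$ be the graph obtained from $T_n$ by subdividing all of its boundary cells. Then: 1. for every set $S$ of cells of $T_n$ that contains at least one interior cell of $T_n$, the graph obtained from $T_n$ by subdividing $S$ is not word-representable; 2. $A_n$ is word-representable; 3. $A_n$ is the maximum subdivision of $T_n$: the set of all boundary cells of $T_n$ is the unique set of cells giving a maximal word-representable subdivision of $T_n$. -/

import Mathlib

namespace TriGrid

/-! ### Word-representable graphs -/

open Classical in
/-- `x` and `y` alternate in the word `w`: after deleting all other letters, no two consecutive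
letters are equal, that is, what remains is `xyxy⋯` or `yxyx⋯`. -/
def Alternate {V : Type*} (w : List V) (x y : V) : Prop :=
  (w.filter (fun z => decide (z = x ∨ z = y))).IsChain (· ≠ ·)

/-- A graph is word-representable if some word over its vertex set has the property that any two
distinct letters alternate in it exactly when they are adjacent. -/
def WordRepresentable {V : Type*} (G : SimpleGraph V) : Prop :=
  ∃ w : List V, ∀ x y : V, x ≠ y → (Alternate w x y ↔ G.Adj x y)

/-! ### The infinite triangular grid and its cells -/

/-- The point of the Euclidean plane with grid coordinates `(x, y)`, namely `x p + y q` with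
`p = (1, 0)` and `q = (1/2, √3/2)`. -/
noncomputable def position (v : ℤ × ℤ) : EuclideanSpace ℝ (Fin 2) :=
  !₂[(v.1 : ℝ) + (v.2 : ℝ) / 2, (v.2 : ℝ) * Real.sqrt 3 / 2]

/-- The triangular tiling graph: vertices are the points of the grid, and two of them are adjacent
if and only if their Euclidean distance is `1` (see `triangularTiling_adj_iff_dist`); the squared
distance is written out in grid coordinates. -/
def triangularTiling : SimpleGraph (ℤ × ℤ) where
  Adj u v := (u.1 - v.1) ^ 2 + (u.1 - v.1) * (u.2 - v.2) + (u.2 - v.2) ^ 2 = 1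
  symm := ⟨fun u v h => by rw [← h]; ring⟩
  loopless := ⟨fun u h => by simp at h⟩

theorem triangularTiling_adj_iff_dist (u v : ℤ × ℤ) :
    triangularTiling.Adj u v ↔ dist (position u) (position v) = 1 := by
  have h3 : Real.sqrt 3 ^ 2 = 3 := Real.sq_sqrt (by norm_num)
  have key : dist (position u) (position v) ^ 2 =
      (((u.1 - v.1) ^ 2 + (u.1 - v.1) * (u.2 - v.2) + (u.2 - v.2) ^ 2 : ℤ) : ℝ) := by
    rw [EuclideanSpace.dist_eq, Real.sq_sqrt (by positivity)]
    simp [Fin.sum_univ_two, Real.dist_eq, sq_abs, position]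
    linear_combination (((u.2 : ℝ) - v.2) ^ 2 / 4) * h3
  have hd : dist (position u) (position v) = 1 ↔ dist (position u) (position v) ^ 2 = 1 := by
    exact (pow_eq_one_iff_of_nonneg dist_nonneg two_ne_zero).symm
  rw [hd, key]
  exact_mod_cast Iff.rfl

/-- A cell (triangular face) of the tiling: `(x, y, true)` is the upward triangle whose lower left
corner is `(x, y)`, and `(x, y, false)` is the downward triangle that shares with it the edge
joining `(x + 1, y)` to `(x, y + 1)`. -/
abbrev Cell := ℤ × ℤ × Bool

/-- The three vertices of a cell. -/
def Cell.verts : Cell → Finset (ℤ × ℤ)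
  | (x, y, true) => {(x, y), (x + 1, y), (x, y + 1)}
  | (x, y, false) => {(x + 1, y + 1), (x + 1, y), (x, y + 1)}

/-- Any two distinct vertices of a cell are adjacent in the tiling. -/
theorem Cell.adj {c : Cell} {u v : ℤ × ℤ} (hu : u ∈ c.verts) (hv : v ∈ c.verts) (h : u ≠ v) :
    triangularTiling.Adj u v := by
  obtain ⟨x, y, _ | _⟩ := c <;>
  simp only [Cell.verts, Finset.mem_insert, Finset.mem_singleton] at hu hv <;>
  rcases hu with rfl | rfl | rfl <;> rcases hv with rfl | rfl | rfl <;>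
  first
    | exact absurd rfl h
    | (simp only [triangularTiling]; ring)

/-! ### Triangular grid graphs -/

/-- The subgraph of the tiling formed by all the edges (with their endpoints) that bound a cell
of `C`. -/
def ofCells (C : Set Cell) : triangularTiling.Subgraph where
  verts := {v | ∃ c ∈ C, v ∈ c.verts}
  Adj u v := u ≠ v ∧ ∃ c ∈ C, u ∈ c.verts ∧ v ∈ c.verts
  adj_sub := fun ⟨h, _, _, hu, hv⟩ => Cell.adj hu hv h
  edge_vert := fun ⟨_, c, hc, hu, _⟩ => ⟨c, hc, hu⟩
  symm := ⟨fun _ _ ⟨h, c, hc, hu, hv⟩ => ⟨h.symm, c, hc, hv, hu⟩⟩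

/-- A triangular grid graph is formed by all the edges bounding finitely many cells. -/
def IsTriangularGridGraph (G : triangularTiling.Subgraph) : Prop :=
  ∃ C : Set Cell, C.Finite ∧ G = ofCells C

/-- The cells that belong to `G`: those all of whose edges are edges of `G`. -/
def cells (G : triangularTiling.Subgraph) : Set Cell :=
  {c | ∀ u ∈ c.verts, ∀ v ∈ c.verts, u ≠ v → G.Adj u v}

/-- `uv` is a boundary edge of `G`: an edge of `G` shared with a cell of the tiling that does not
belong to `G`. -/
def IsBoundaryEdge (G : triangularTiling.Subgraph) (u v : ℤ × ℤ) : Prop :=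
  G.Adj u v ∧ ∃ d : Cell, d ∉ cells G ∧ u ∈ d.verts ∧ v ∈ d.verts

/-- The boundary cells of `G`: the cells of `G` incident to at least one boundary edge. -/
def boundaryCells (G : triangularTiling.Subgraph) : Set Cell :=
  {c | c ∈ cells G ∧ ∃ u ∈ c.verts, ∃ v ∈ c.verts, IsBoundaryEdge G u v}

/-- The interior cells of `G`: the cells of `G` that are not boundary cells. -/
def interiorCells (G : triangularTiling.Subgraph) : Set Cell :=
  cells G \ boundaryCells G

/-! ### Subdivisions -/

/-- The graph obtained from `G` by subdividing the cells in `S`: for each cell in `S` there is one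
new vertex, adjacent exactly to the three vertices of that cell. (Used for `S ⊆ cells G`.) -/
def subdivision (G : triangularTiling.Subgraph) (S : Set Cell) : SimpleGraph (G.verts ⊕ S) where
  Adj
    | .inl u, .inl v => G.Adj u v
    | .inl u, .inr c => (u : ℤ × ℤ) ∈ (c : Cell).verts
    | .inr c, .inl u => (u : ℤ × ℤ) ∈ (c : Cell).verts
    | .inr _, .inr _ => False
  symm := ⟨by
    rintro (u | c) (v | d) h
    · exact G.adj_symm h
    · exact h
    · exact h
    · exact h⟩
  loopless := ⟨by
    rintro (u | c) h
    · exact G.loopless.irrefl _ h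
    · exact h⟩

/-- Subdividing the set `S` of cells of `G` is a maximal word-representable subdivision: the result
is word-representable, but subdividing any other cell of `G` in addition makes it
non-word-representable. -/
def IsMaximalSubdivision (G : triangularTiling.Subgraph) (S : Set Cell) : Prop :=
  S ⊆ cells G ∧ WordRepresentable (subdivision G S) ∧
    ∀ c ∈ cells G, c ∉ S → ¬ WordRepresentable (subdivision G (insert c S))

/-- Subdividing `S` is the maximum subdivision of `G`: the unique maximal word-representable
subdivision. -/
def IsMaximumSubdivision (G : triangularTiling.Subgraph) (S : Set Cell) : Prop :=
  IsMaximalSubdivision G S ∧ ∀ S' : Set Cell, IsMaximalSubdivision G S' → S' = S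

/-! ### Grid graphs of equilateral triangle shape -/

/-- The cells inside the equilateral triangle of side length `n` with corners `(0, 0)`, `(n, 0)`,
`(0, n)` in grid coordinates. -/
def triangleCells (n : ℕ) : Set Cell :=
  {c | ∀ v ∈ c.verts, 0 ≤ v.1 ∧ 0 ≤ v.2 ∧ v.1 + v.2 ≤ n}

/-- The triangular grid graph `T n` of equilateral triangle shape with `n` levels, so that each of
its sides consists of `n` edges. -/
def T (n : ℕ) : triangularTiling.Subgraph := ofCells (triangleCells n)

theorem isTriangularGridGraph_T (n : ℕ) : IsTriangularGridGraph (T n) := by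
  refine ⟨triangleCells n, ?_, rfl⟩
  refine ((Set.finite_Icc (-1 : ℤ) n).prod
    ((Set.finite_Icc (-1 : ℤ) n).prod (Set.finite_univ (α := Bool)))).subset ?_
  rintro ⟨x, y, _ | _⟩ h <;>
  simp only [triangleCells, Cell.verts, Set.mem_ofPred_eq, Finset.mem_insert, Finset.mem_singleton,
    forall_eq_or_imp, forall_eq] at h <;>
  simp only [Set.mem_prod, Set.mem_Icc, Set.mem_univ, and_true] <;> omega

/-- The graph `A n` obtained from `T n` by subdividing all of its boundary cells. -/
def A (n : ℕ) : SimpleGraph ((T n).verts ⊕ boundaryCells (T n)) :=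
  subdivision (T n) (boundaryCells (T n))

end TriGrid

namespace TriGrid

/-! ### Alternation in words through letter counts -/

/-! Two letters alternate exactly when the difference of their prefix counts takes at most two
consecutive values (`alternate_iff_interlaced`). After shifting by constants, the counts of a
4-clique form a chain that drops by at most one, so the clique is cyclically ordered. By
`interlaced_or_of_chain`, a vertex interlaced with two opposite members of this cycle is interlaced
with a third. A subdivided interior cell and its new vertex `d` form a 4-clique. Whichever cell
vertex lies opposite `d`, the apex of the cell across the edge joining the other two sees just those
two. This contradiction is `not_wordRepresentable_of_clique`.

For the converse, colour the triangular grid properly with three colours, arranged as levels 0, 2, 4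
on a cycle of length six. For a boundary cell choose a boundary edge directed counterclockwise from
`r` to `p`, along which the colour rises by one, and put the new vertex at the odd level between
them. Listing the vertices by level twice makes each edge alternate. One full turn of the cycle,
started at any level, may be rearranged by moving a set closed under passing to later neighbours to
the end: the order on edges survives, while a non-edge leaving the set is broken. Concatenating one
such word per non-edge gives a representing word (`wordRepresentable_of_isSeparated`). The
separating sets are built from neighbourhoods. They exist because a boundary edge lies in a single
cell and the chosen edges form induced directed paths.

Maximality and uniqueness follow since word-representability passes to smaller subdivisions. -/

open Classical in
/-- The number of occurrences of the letter `x` among the first `i` letters of `w`. -/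
noncomputable def prefixCount {V : Type*} (w : List V) (x : V) (i : ℕ) : ℤ :=
  ((w.take i).count x : ℕ)

/-- Two integer sequences whose difference takes at most two values, these being consecutive. -/
def Interlaced (f g : ℕ → ℤ) : Prop :=
  ∃ k : ℤ, ∀ i, k ≤ f i - g i ∧ f i - g i ≤ k + 1

theorem prefixCount_zero {V : Type*} (w : List V) (x : V) : prefixCount w x 0 = 0 := by
  simp [prefixCount]

theorem prefixCount_cons_self {V : Type*} (w : List V) (x : V) (i : ℕ) :
    prefixCount (x :: w) x (i + 1) = prefixCount w x i + 1 := by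
  simp [prefixCount]

theorem prefixCount_cons_of_ne {V : Type*} (w : List V) {x y : V} (h : y ≠ x) (i : ℕ) :
    prefixCount (y :: w) x (i + 1) = prefixCount w x i := by
  simp [prefixCount, h]

-- The prepended `x` forces `y` to be the first of the two letters in `w`, so `y` leads by 0 or 1
-- throughout. Reading that `y` exchanges the roles of the letters, hence the induction generalizes
-- over both.
open Classical in
theorem isChain_cons_filter_iff {V : Type*} (w : List V) (x y : V) (h : x ≠ y) :
    (x :: w.filter (fun z => decide (z = x ∨ z = y))).IsChain (· ≠ ·) ↔
      ∀ i, 0 ≤ prefixCount w y i - prefixCount w x i ∧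
        prefixCount w y i - prefixCount w x i ≤ 1 := by
  induction w generalizing x y with
  | nil => simp [prefixCount]
  | cons a w ih =>
    by_cases hx : a = x
    · subst hx
      have h1 := prefixCount_cons_self w a 0
      have h2 := prefixCount_cons_of_ne w h 0
      rw [prefixCount_zero] at h1 h2
      simp only [List.filter_cons, true_or, decide_true, if_true, List.isChain_cons_cons, ne_eq,
        not_true_eq_false, false_and, false_iff]
      intro H
      have := H (0 + 1)
      omega
    by_cases hy : a = y
    · subst hy
      have e : w.filter (fun z => decide (z = x ∨ z = a)) =
          w.filter (fun z => decide (z = a ∨ z = x)) := by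
        congr 1; funext z; simp [or_comm]
      rw [List.filter_cons_of_pos (by simp), List.isChain_cons_cons, e, ih a x h.symm]
      constructor
      · rintro ⟨-, H⟩ (_ | i)
        · simp [prefixCount_zero]
        · rw [prefixCount_cons_self, prefixCount_cons_of_ne w hx]
          have := H i
          omega
      · intro H
        refine ⟨h, fun i => ?_⟩
        have := H (i + 1)
        rw [prefixCount_cons_self, prefixCount_cons_of_ne w hx] at this
        omega
    · rw [List.filter_cons_of_neg (by simp [hx, hy]), ih x y h]
      constructor
      · rintro H (_ | i)
        · simp [prefixCount_zero]
        · rw [prefixCount_cons_of_ne w hx, prefixCount_cons_of_ne w hy]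
          exact H i
      · intro H i
        have := H (i + 1)
        rwa [prefixCount_cons_of_ne w hx, prefixCount_cons_of_ne w hy] at this

theorem isChain_ne_iff_cons {V : Type*} {l : List V} {x y : V} (h : x ≠ y)
    (hl : ∀ z ∈ l, z = x ∨ z = y) :
    l.IsChain (· ≠ ·) ↔ (x :: l).IsChain (· ≠ ·) ∨ (y :: l).IsChain (· ≠ ·) := by
  cases l with
  | nil => simp
  | cons a l =>
    simp only [List.isChain_cons_cons]
    rcases hl a (by simp) with rfl | rfl <;> simp [h, h.symm]

theorem alternate_iff_interlaced {V : Type*} (w : List V) {x y : V} (h : x ≠ y) :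
    Alternate w x y ↔ Interlaced (prefixCount w x) (prefixCount w y) := by
  classical
  have e : w.filter (fun z => decide (z = x ∨ z = y)) =
      w.filter (fun z => decide (z = y ∨ z = x)) := by
    congr 1; funext z; simp [or_comm]
  have h1 := isChain_cons_filter_iff w x y h
  have h2 := isChain_cons_filter_iff w y x h.symm
  rw [← e] at h2
  have h3 := isChain_ne_iff_cons (l := w.filter (fun z => decide (z = x ∨ z = y))) h (by simp)
  rw [h1, h2] at h3
  have h4 : Alternate w x y ↔
      (w.filter (fun z => decide (z = x ∨ z = y))).IsChain (· ≠ ·) := by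
    unfold Alternate
    convert Iff.rfl
  rw [h4, h3]
  constructor
  · rintro (H | H)
    · exact ⟨-1, fun i => by have := H i; omega⟩
    · exact ⟨0, fun i => by have := H i; omega⟩
  · rintro ⟨k, H⟩
    have h0 := H 0
    simp only [prefixCount_zero] at h0
    obtain rfl | rfl : k = -1 ∨ k = 0 := by omega
    · exact Or.inl fun i => by have := H i; omega
    · exact Or.inr fun i => by have := H i; omega

/-! ### A non-word-representable graph on seven vertices -/

theorem Interlaced.symm {f g : ℕ → ℤ} (h : Interlaced f g) : Interlaced g f := by
  obtain ⟨k, h⟩ := h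
  exact ⟨-k - 1, fun i => by have := h i; omega⟩

theorem Interlaced.add_const_right {f g : ℕ → ℤ} (h : Interlaced f g) (m : ℤ) :
    Interlaced f (fun i => g i + m) := by
  obtain ⟨k, h⟩ := h
  exact ⟨k - m, fun i => by have := h i; dsimp only; omega⟩

theorem Interlaced.of_add_const_right {f g : ℕ → ℤ} {m : ℤ}
    (h : Interlaced f (fun i => g i + m)) : Interlaced f g := by
  obtain ⟨k, h⟩ := h
  exact ⟨k + m, fun i => by have := h i; dsimp only at this; omega⟩

/-- Two consecutive integers never have strictly opposite signs. This turns the pairwise interlacing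
of a clique into comparabilities. -/
theorem Interlaced.le_or_le {f g : ℕ → ℤ} (h : Interlaced f g) :
    (∀ i, f i ≤ g i) ∨ ∀ i, g i ≤ f i := by
  obtain ⟨k, h⟩ := h
  by_cases hk : 0 ≤ k
  · exact Or.inr fun i => by have := h i; omega
  · exact Or.inl fun i => by have := h i; omega

/-- In the cyclic order `d, f, g, h` the pairs `f, h` and `d, g` are opposite. Let `c - f` and `c -
h` have lower bounds `k` and `m`. If `m ≤ k`, then `g`, squeezed between `h` and `f`, inherits the
window of `f`; otherwise `d`, squeezed between `f` and `h + 1`, does. -/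
theorem interlaced_or_of_chain {d f g h c : ℕ → ℤ} (hdf : ∀ i, f i ≤ d i) (hfg : ∀ i, g i ≤ f i)
    (hgh : ∀ i, h i ≤ g i) (hhd : ∀ i, d i ≤ h i + 1) (hcf : Interlaced c f)
    (hch : Interlaced c h) : Interlaced c d ∨ Interlaced c g := by
  obtain ⟨k, hk⟩ := hcf
  obtain ⟨m, hm⟩ := hch
  by_cases hkm : m ≤ k
  · refine Or.inr ⟨k, fun i => ?_⟩
    have := hdf i; have := hfg i; have := hgh i; have := hhd i; have := hk i; have := hm i
    omega
  · refine Or.inl ⟨k, fun i => ?_⟩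
    have := hdf i; have := hfg i; have := hgh i; have := hhd i; have := hk i; have := hm i
    omega

/-- A graph is not word-representable if it contains a clique on `d, x, y, z` and vertices
`a, b, c` whose neighbourhoods meet this clique in `{y, z}`, `{x, z}`, `{x, y}` respectively. -/
theorem not_wordRepresentable_of_clique {V : Type*} (G : SimpleGraph V) {d x y z a b c : V}
    (hdx : G.Adj d x) (hdy : G.Adj d y) (hdz : G.Adj d z)
    (hxy : G.Adj x y) (hxz : G.Adj x z) (hyz : G.Adj y z)
    (hay : G.Adj a y) (haz : G.Adj a z) (hbx : G.Adj b x) (hbz : G.Adj b z)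
    (hcx : G.Adj c x) (hcy : G.Adj c y)
    (had : ¬ G.Adj a d) (hbd : ¬ G.Adj b d) (hcd : ¬ G.Adj c d)
    (hax : ¬ G.Adj a x) (hby : ¬ G.Adj b y) (hcz : ¬ G.Adj c z)
    (had' : a ≠ d) (hbd' : b ≠ d) (hcd' : c ≠ d) (hax' : a ≠ x) (hby' : b ≠ y) (hcz' : c ≠ z) :
    ¬ WordRepresentable G := by
  rintro ⟨w, hw⟩
  have pos : ∀ {u v}, G.Adj u v → Interlaced (prefixCount w u) (prefixCount w v) :=
    fun h => (alternate_iff_interlaced w h.ne).1 ((hw _ _ h.ne).2 h)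
  have neg : ∀ {u v}, u ≠ v → ¬ G.Adj u v → ¬ Interlaced (prefixCount w u) (prefixCount w v) :=
    fun hne h hi => h ((hw _ _ hne).1 ((alternate_iff_interlaced w hne).2 hi))
  obtain ⟨k, hk⟩ := pos hdx
  obtain ⟨l, hl⟩ := pos hdy
  obtain ⟨m, hm⟩ := pos hdz
  replace hk : ∀ i, prefixCount w x i + k ≤ prefixCount w d i ∧
      prefixCount w d i ≤ prefixCount w x i + k + 1 := fun i => by have := hk i; omega
  replace hl : ∀ i, prefixCount w y i + l ≤ prefixCount w d i ∧
      prefixCount w d i ≤ prefixCount w y i + l + 1 := fun i => by have := hl i; omega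
  replace hm : ∀ i, prefixCount w z i + m ≤ prefixCount w d i ∧
      prefixCount w d i ≤ prefixCount w z i + m + 1 := fun i => by have := hm i; omega
  -- The shifts by `k`, `l`, `m` put the counts of `x`, `y`, `z` at most one below that of `d`.
  have exy := (((pos hxy).add_const_right l).symm.add_const_right k).symm.le_or_le
  have exz := (((pos hxz).add_const_right m).symm.add_const_right k).symm.le_or_le
  have eyz := (((pos hyz).add_const_right m).symm.add_const_right l).symm.le_or_le
  have ha : ¬ (Interlaced (prefixCount w a) (prefixCount w d) ∨
      Interlaced (prefixCount w a) (fun i => prefixCount w x i + k)) := fun h =>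
    h.elim (neg had' had) fun h => neg hax' hax h.of_add_const_right
  have hb : ¬ (Interlaced (prefixCount w b) (prefixCount w d) ∨
      Interlaced (prefixCount w b) (fun i => prefixCount w y i + l)) := fun h =>
    h.elim (neg hbd' hbd) fun h => neg hby' hby h.of_add_const_right
  have hc : ¬ (Interlaced (prefixCount w c) (prefixCount w d) ∨
      Interlaced (prefixCount w c) (fun i => prefixCount w z i + m)) := fun h =>
    h.elim (neg hcd' hcd) fun h => neg hcz' hcz h.of_add_const_right
  have ay := (pos hay).add_const_right l
  have az := (pos haz).add_const_right m
  have bx := (pos hbx).add_const_right k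
  have bz := (pos hbz).add_const_right m
  have cx := (pos hcx).add_const_right k
  have cy := (pos hcy).add_const_right l
  -- In each case two of the comparisons give a chain below `d`, and the vertex among `a, b, c` not
  -- adjacent to its middle member yields the contradiction. The two cyclic sign patterns fit the
  -- same scheme.
  rcases exy with exy | exy <;> rcases exz with exz | exz <;> rcases eyz with eyz | eyz
  · exact hb (interlaced_or_of_chain (fun i => (hm i).1) eyz exy (fun i => (hk i).2) bz bx)
  · exact hc (interlaced_or_of_chain (fun i => (hl i).1) eyz exz (fun i => (hk i).2) cy cx)
  · exact hb (interlaced_or_of_chain (fun i => (hm i).1) eyz exy (fun i => (hk i).2) bz bx)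
  · exact ha (interlaced_or_of_chain (fun i => (hl i).1) exy exz (fun i => (hm i).2) ay az)
  · exact ha (interlaced_or_of_chain (fun i => (hm i).1) exz exy (fun i => (hl i).2) az ay)
  · exact hb (interlaced_or_of_chain (fun i => (hk i).1) exy eyz (fun i => (hm i).2) bx bz)
  · exact hc (interlaced_or_of_chain (fun i => (hk i).1) exz eyz (fun i => (hl i).2) cx cy)
  · exact hb (interlaced_or_of_chain (fun i => (hk i).1) exy eyz (fun i => (hm i).2) bx bz)

/-- Word-representability is inherited by induced subgraphs. -/
theorem WordRepresentable.comap {V W : Type*} {G : SimpleGraph W} (hG : WordRepresentable G)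
    (f : V ↪ W) : WordRepresentable (G.comap f) := by
  classical
  obtain ⟨w, hw⟩ := hG
  let g : W → Option V := fun a => if h : ∃ v, f v = a then some h.choose else none
  have hg : ∀ a v, g a = some v ↔ a = f v := by
    intro a v
    by_cases h : ∃ v, f v = a
    · simp only [g, dif_pos h, Option.some.injEq]
      constructor
      · rintro rfl
        exact h.choose_spec.symm
      · intro e
        exact f.injective (h.choose_spec.trans e)
    · simp only [g, dif_neg h]
      constructor
      · simp
      · rintro rfl
        exact absurd ⟨v, rfl⟩ h
  refine ⟨w.filterMap g, fun x y hxy => ?_⟩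
  rw [SimpleGraph.comap_adj, ← hw _ _ (f.injective.ne hxy)]
  have key : ((w.filterMap g).filter (fun z => decide (z = x ∨ z = y))).map f =
      w.filter (fun z => decide (z = f x ∨ z = f y)) := by
    clear hw
    induction w with
    | nil => rfl
    | cons a w ih =>
      cases hga : g a with
      | none =>
        have hx : a ≠ f x := fun e => by simp [(hg a x).2 e] at hga
        have hy : a ≠ f y := fun e => by simp [(hg a y).2 e] at hga
        rw [List.filterMap_cons_none hga, List.filter_cons_of_neg (by simp [hx, hy]), ih]
      | some v =>
        obtain rfl := (hg a v).1 hga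
        rw [List.filterMap_cons_some hga]
        by_cases hv : v = x ∨ v = y
        · rw [List.filter_cons_of_pos (by simpa using hv), List.map_cons, ih,
            List.filter_cons_of_pos (by simpa [f.injective.eq_iff] using hv)]
        · rw [List.filter_cons_of_neg (by simpa using hv), ih,
            List.filter_cons_of_neg (by simpa [f.injective.eq_iff] using hv)]
  have h1 : Alternate (w.filterMap g) x y ↔
      ((w.filterMap g).filter (fun z => decide (z = x ∨ z = y))).IsChain (· ≠ ·) := by
    unfold Alternate
    convert Iff.rfl
  have h2 : Alternate w (f x) (f y) ↔
      (w.filter (fun z => decide (z = f x ∨ z = f y))).IsChain (· ≠ ·) := by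
    unfold Alternate
    convert Iff.rfl
  rw [h1, h2, ← key, List.isChain_map]
  simp [f.injective.ne_iff]

/-! ### Words from levels -/

open Classical in
theorem alternate_iff_isChain {V : Type*} (w : List V) (x y : V) :
    Alternate w x y ↔ (w.filter (fun z => decide (z = x ∨ z = y))).IsChain (· ≠ ·) := by
  unfold Alternate
  convert Iff.rfl

theorem isChain_flatMap_pair {ι V : Type*} (l : List ι) {x y : V} (h : x ≠ y) :
    (l.flatMap fun _ => [x, y, x, y]).IsChain (· ≠ ·) := by
  have key : (y :: l.flatMap fun _ => [x, y, x, y]).IsChain (· ≠ ·) := by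
    induction l with
    | nil => simp
    | cons a l ih => simp [h, h.symm, ih]
  exact key.tail

open Classical in
/-- Words in which every edge, oriented by `R`, reads `xyxy` can be concatenated: it suffices to
find for each non-edge such a word in which it does not alternate. -/
theorem wordRepresentable_of_forall_not_adj {V : Type*} [Finite V] (G : SimpleGraph V)
    (R : V → V → Prop) (hR : ∀ x y, G.Adj x y → R x y ∨ R y x)
    (h : ∀ u v, u ≠ v → ¬ G.Adj u v → ∃ w : List V, (∀ x y, G.Adj x y → R x y →
      w.filter (fun z => decide (z = x ∨ z = y)) = [x, y, x, y]) ∧ ¬ Alternate w u v) :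
    WordRepresentable G := by
  have := Fintype.ofFinite V
  let ι := {e : V × V // e.1 ≠ e.2 ∧ ¬ G.Adj e.1 e.2}
  have h' : ∀ e : ι, ∃ w : List V, (∀ x y, G.Adj x y → R x y →
      w.filter (fun z => decide (z = x ∨ z = y)) = [x, y, x, y]) ∧
        ¬ Alternate w e.1.1 e.1.2 := fun e => h _ _ e.2.1 e.2.2
  choose W hW hW' using h'
  let w := (Finset.univ : Finset ι).toList.flatMap W
  have edge : ∀ x y, G.Adj x y → R x y → Alternate w x y := by
    intro x y hxy hr
    rw [alternate_iff_isChain, List.filter_flatMap]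
    simp only [hW _ x y hxy hr]
    exact isChain_flatMap_pair _ hxy.ne
  refine ⟨w, fun x y hxy => ⟨fun ha => ?_, fun ha => ?_⟩⟩
  · by_contra hn
    refine hW' ⟨(x, y), hxy, hn⟩ ?_
    rw [alternate_iff_isChain] at ha ⊢
    refine ha.infix (List.IsInfix.filter _ ?_)
    exact List.infix_of_mem_flatten (List.mem_map.2
      ⟨⟨(x, y), hxy, hn⟩, Finset.mem_toList.2 (Finset.mem_univ _), rfl⟩)
  · rcases hR x y ha with hr | hr
    · exact edge x y ha hr
    · have := edge y x ha.symm hr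
      rw [alternate_iff_isChain] at this ⊢
      simpa only [or_comm] using this

theorem exists_list_pairwise_le {V : Type*} [Finite V] (ℓ : V → ℤ) :
    ∃ L : List V, L.Nodup ∧ (∀ x, x ∈ L) ∧ L.Pairwise (fun x y => ℓ x ≤ ℓ y) := by
  classical
  have := Fintype.ofFinite V
  let r : V → V → Prop := fun x y => ℓ x ≤ ℓ y
  have : Std.Total r := ⟨fun x y => le_total _ _⟩
  have : IsTrans V r := ⟨fun x y z => le_trans⟩
  refine ⟨(Finset.univ : Finset V).toList.insertionSort r, ?_, ?_, List.pairwise_insertionSort r _⟩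
  · exact (List.perm_insertionSort r _).nodup_iff.2 (Finset.nodup_toList _)
  · simp

open Classical in
theorem filter_pair_eq {V : Type*} {L : List V} (hL : L.Nodup) {x y : V} (hx : x ∈ L)
    (hy : y ∈ L) (hxy : x ≠ y) :
    L.filter (fun z => decide (z = x ∨ z = y)) = [x, y] ∨
      L.filter (fun z => decide (z = x ∨ z = y)) = [y, x] := by
  have : (L.filter (fun z => decide (z = x ∨ z = y))).Perm [x, y] := by
    rw [List.perm_ext_iff_of_nodup (hL.filter _) (by simp [hxy])]
    intro a
    simp only [List.mem_filter, decide_eq_true_eq, List.mem_cons, List.not_mem_nil, or_false]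
    constructor
    · exact fun h => h.2
    · rintro (rfl | rfl) <;> simp [*]
  exact List.perm_pair.1 this

/-- The position of the level `a` in the cyclic order of six levels that starts with `s`. -/
def offset (s a : ℤ) : ℤ := (a - s) % 6

open Classical in
/-- Two copies of the list `L` (sorted by level), where between the levels below `s` of the first
copy and the levels from `s` on of the second copy, the letters outside `U` precede those of `U`. -/
noncomputable def cutWord {V : Type*} (ℓ : V → ℤ) (s : ℤ) (U : Set V) (L : List V) : List V :=
  L.filter (fun z => decide (ℓ z < s)) ++
    ((L.filter (fun z => decide (s ≤ ℓ z)) ++ L.filter (fun z => decide (ℓ z < s))).filter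
        (fun z => decide (z ∉ U)) ++
      (L.filter (fun z => decide (s ≤ ℓ z)) ++ L.filter (fun z => decide (ℓ z < s))).filter
        (fun z => decide (z ∈ U))) ++
    L.filter (fun z => decide (s ≤ ℓ z))

theorem filter_cutWord {V : Type*} (ℓ : V → ℤ) (s : ℤ) (U : Set V) (L : List V) (q : V → Bool) :
    (cutWord ℓ s U L).filter q = cutWord ℓ s U (L.filter q) := by
  simp only [cutWord, List.filter_append, List.filter_filter, Bool.and_comm, Bool.and_assoc]

/-- Closure of `U` along the edge, in the order of offsets, prevents the rearranged middle part from
swapping its endpoints. -/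
theorem cutWord_pair_of_adj {V : Type*} {ℓ : V → ℤ} {s : ℤ} {U : Set V} {x y : V}
    (hℓ : ∀ x, 0 ≤ ℓ x ∧ ℓ x < 6) (hs : 0 ≤ s ∧ s < 6) (hxy : ℓ x < ℓ y)
    (h1 : offset s (ℓ x) < offset s (ℓ y) → x ∈ U → y ∈ U)
    (h2 : offset s (ℓ y) < offset s (ℓ x) → y ∈ U → x ∈ U) :
    cutWord ℓ s U [x, y] = [x, y, x, y] := by
  have hx := hℓ x
  have hy := hℓ y
  unfold offset at h1 h2
  rcases lt_or_ge (ℓ x) s with hxs | hxs <;> rcases lt_or_ge (ℓ y) s with hys | hys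
  · have := h1 (by omega)
    by_cases hxU : x ∈ U <;> by_cases hyU : y ∈ U <;>
      simp_all [cutWord]
  · have := h2 (by omega)
    by_cases hxU : x ∈ U <;> by_cases hyU : y ∈ U <;>
      simp_all [cutWord]
  · omega
  · have := h1 (by omega)
    by_cases hxU : x ∈ U <;> by_cases hyU : y ∈ U <;>
      simp_all [cutWord]

/-- The middle part reads `v u` instead of `u v`, which creates a repeated letter where it meets the
unchanged beginning or end of the word. -/
theorem not_isChain_cutWord_pair {V : Type*} {ℓ : V → ℤ} {s : ℤ} {U : Set V} {u v : V}
    (hℓ : ∀ x, 0 ≤ ℓ x ∧ ℓ x < 6) (hs : 0 ≤ s ∧ s < 6)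
    (huv : offset s (ℓ u) < offset s (ℓ v)) (hu : u ∈ U) (hv : v ∉ U) :
    ¬ (cutWord ℓ s U (if ℓ u < ℓ v then [u, v] else [v, u])).IsChain (· ≠ ·) := by
  have hu' := hℓ u
  have hv' := hℓ v
  unfold offset at huv
  rcases lt_or_ge (ℓ u) s with hus | hus <;> rcases lt_or_ge (ℓ v) s with hvs | hvs
  · rw [if_pos (by omega)]
    simp_all [cutWord]
  · omega
  · rw [if_neg (by omega)]
    simp_all [cutWord]
  · rw [if_pos (by omega)]
    simp_all [cutWord]

/-- The non-edge `uv` is separated by a set that contains `u` but not the later vertex `v`, and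
that with a vertex contains all its later neighbours, with respect to the cyclic order of levels
cut at some level. -/
def IsSeparated {V : Type*} (G : SimpleGraph V) (ℓ : V → ℤ) (u v : V) : Prop :=
  ∃ (s : ℤ) (U : Set V), 0 ≤ s ∧ s < 6 ∧
    (∀ x y, x ∈ U → G.Adj x y → offset s (ℓ x) < offset s (ℓ y) → y ∈ U) ∧
    offset s (ℓ u) < offset s (ℓ v) ∧ u ∈ U ∧ v ∉ U

/-- A finite graph whose vertices have six cyclically ordered levels is word-representable if
adjacent vertices have distinct levels and all non-adjacent vertices of distinct levels can be
separated. -/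
theorem wordRepresentable_of_isSeparated {V : Type*} [Finite V] (G : SimpleGraph V) (ℓ : V → ℤ)
    (hℓ : ∀ x, 0 ≤ ℓ x ∧ ℓ x < 6) (hadj : ∀ x y, G.Adj x y → ℓ x ≠ ℓ y)
    (hsep : ∀ u v, u ≠ v → ¬ G.Adj u v → ℓ u ≠ ℓ v → IsSeparated G ℓ u v ∨ IsSeparated G ℓ v u) :
    WordRepresentable G := by
  classical
  obtain ⟨L, hL, hmem, hsort⟩ := exists_list_pairwise_le ℓ
  have hlt : ∀ x y, ℓ x < ℓ y → L.filter (fun z => decide (z = x ∨ z = y)) = [x, y] := by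
    intro x y hxy
    rcases filter_pair_eq hL (hmem x) (hmem y) (fun h => by simp [h] at hxy) with h | h
    · exact h
    · have := hsort.filter (fun z => decide (z = x ∨ z = y))
      rw [h] at this
      simp at this
      omega
  have hcomm : ∀ x y : V, (fun z => decide (z = x ∨ z = y)) =
      fun z => decide (z = y ∨ z = x) := fun x y => by funext z; simp [or_comm]
  refine wordRepresentable_of_forall_not_adj G (fun x y => ℓ x < ℓ y)
    (fun x y h => lt_or_gt_of_ne (hadj x y h)) fun u v huv hn => ?_
  have good : ∀ s U, 0 ≤ s → s < 6 →
      (∀ x y, x ∈ U → G.Adj x y → offset s (ℓ x) < offset s (ℓ y) → y ∈ U) →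
      ∀ x y, G.Adj x y → ℓ x < ℓ y →
        (cutWord ℓ s U L).filter (fun z => decide (z = x ∨ z = y)) = [x, y, x, y] := by
    intro s U h0 h6 hU x y hxy hl
    rw [filter_cutWord, hlt x y hl]
    exact cutWord_pair_of_adj hℓ ⟨h0, h6⟩ hl (fun h hx => hU x y hx hxy h)
      (fun h hy => hU y x hy hxy.symm h)
  have sep : ∀ u v, IsSeparated G ℓ u v → ∃ w : List V, (∀ x y, G.Adj x y → ℓ x < ℓ y →
      w.filter (fun z => decide (z = x ∨ z = y)) = [x, y, x, y]) ∧ ¬ Alternate w u v := by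
    rintro u v ⟨s, U, h0, h6, hU, huv, hu, hv⟩
    refine ⟨cutWord ℓ s U L, good s U h0 h6 hU, ?_⟩
    rw [alternate_iff_isChain, filter_cutWord]
    have := not_isChain_cutWord_pair hℓ ⟨h0, h6⟩ huv hu hv
    split_ifs at this with h
    · rwa [hlt u v h]
    · rwa [hcomm, hlt v u (lt_of_le_of_ne (not_lt.1 h) (fun e => by simp [e] at huv))]
  by_cases he : ℓ u = ℓ v
  -- When the cycle is cut at the level of `a`, nothing has smaller offset than `a`, so `{a}ᶜ` is
  -- closed and the middle part starts with `a`. Taking for `a` the later of `u, v` in `L` swaps the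
  -- pair.
  · have single : ∀ a, ∀ x y, G.Adj x y → ℓ x < ℓ y →
        (cutWord ℓ (ℓ a) {a}ᶜ L).filter (fun z => decide (z = x ∨ z = y)) = [x, y, x, y] := by
      intro a
      refine good _ _ (hℓ a).1 (hℓ a).2 ?_
      rintro x y - - h rfl
      have := hℓ x
      simp only [offset] at h
      omega
    rcases filter_pair_eq hL (hmem u) (hmem v) huv with h | h
    · refine ⟨cutWord ℓ (ℓ v) {v}ᶜ L, single v, ?_⟩
      rw [alternate_iff_isChain, filter_cutWord, h]
      simp [cutWord, he, huv, huv.symm]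
    · refine ⟨cutWord ℓ (ℓ u) {u}ᶜ L, single u, ?_⟩
      rw [alternate_iff_isChain, filter_cutWord, h]
      simp [cutWord, he, huv, huv.symm]
  · rcases hsep u v huv hn he with h | h
    · exact sep u v h
    · obtain ⟨w, h1, h2⟩ := sep v u h
      refine ⟨w, h1, ?_⟩
      rw [alternate_iff_isChain] at h2 ⊢
      rwa [hcomm]

/-! ### Separation in properly coloured graphs with added vertices of degree three -/

/-- It suffices to close a separating set up below the offset of `v`. -/
theorem isSeparated_of_core {V : Type*} {G : SimpleGraph V} {ℓ : V → ℤ} {u v : V}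
    (s : ℤ) (hs : 0 ≤ s ∧ s < 6) (C : Set V) (hu : u ∈ C) (hv : v ∉ C)
    (huv : offset s (ℓ u) < offset s (ℓ v))
    (hC : ∀ x ∈ C, ∀ y, G.Adj x y → offset s (ℓ x) < offset s (ℓ y) →
      offset s (ℓ y) < offset s (ℓ v) → y ∈ C)
    (hCv : ∀ x ∈ C, G.Adj x v → offset s (ℓ x) < offset s (ℓ v) → False) :
    IsSeparated G ℓ u v := by
  -- Everything at the offset of `v` or later, except `v`, can be added freely: no edge leads from
  -- there to `v` in increasing offset.
  refine ⟨s, C ∪ {x | offset s (ℓ v) ≤ offset s (ℓ x) ∧ x ≠ v}, hs.1, hs.2, ?_, huv,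
    Or.inl hu, ?_⟩
  · rintro x y hx hxy hlt
    have hyv : offset s (ℓ v) ≤ offset s (ℓ x) →
        y ∈ C ∪ {x | offset s (ℓ v) ≤ offset s (ℓ x) ∧ x ≠ v} :=
      fun h => Or.inr ⟨by omega, fun e => by subst e; omega⟩
    rcases hx with hx | hx
    · rcases lt_or_ge (offset s (ℓ x)) (offset s (ℓ v)) with h | h
      · rcases lt_or_ge (offset s (ℓ y)) (offset s (ℓ v)) with h' | h'
        · exact Or.inl (hC x hx y hxy hlt h')
        · exact Or.inr ⟨h', fun e => hCv x hx (e ▸ hxy) h⟩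
      · exact hyv h
    · exact hyv hx.1
  · rintro (h | h)
    · exact hv h
    · exact h.2 rfl

/-- A graph consisting of a properly 3-coloured graph on `P` and of vertices `c` from `Q`, each
adjacent exactly to a triangle `p c`, `q c`, `r c`, such that the edges from `r c` to `p c` lie in
no other triangle and form induced directed paths. -/
structure BoundarySubdivision {P Q : Type*} (G : SimpleGraph (P ⊕ Q)) where
  col : P → ℤ
  p : Q → P
  q : Q → P
  r : Q → P
  col_nonneg : ∀ a, 0 ≤ col a
  col_lt : ∀ a, col a < 3
  col_ne : ∀ a b, G.Adj (.inl a) (.inl b) → col a ≠ col b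
  adj_cell : ∀ c a, G.Adj (.inr c) (.inl a) ↔ a = p c ∨ a = q c ∨ a = r c
  not_adj_cell : ∀ c d, ¬ G.Adj (.inr c) (.inr d)
  col_p : ∀ c, (col (p c) - col (r c)) % 3 = 1
  col_q : ∀ c, (col (q c) - col (r c)) % 3 = 2
  adj_pq : ∀ c, G.Adj (.inl (p c)) (.inl (q c))
  adj_pr : ∀ c, G.Adj (.inl (p c)) (.inl (r c))
  adj_qr : ∀ c, G.Adj (.inl (q c)) (.inl (r c))
  eq_q : ∀ c a, G.Adj (.inl a) (.inl (p c)) → G.Adj (.inl a) (.inl (r c)) → a = q c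
  induced : ∀ c d, p d = r c → ¬ G.Adj (.inl (r d)) (.inl (p c))

namespace BoundarySubdivision

variable {P Q : Type*} {G : SimpleGraph (P ⊕ Q)}

/-- The level of a coloured vertex is twice its colour; an added vertex `c` comes just between
`r c` and `p c` in the cyclic order of levels. -/
def level (B : BoundarySubdivision G) : P ⊕ Q → ℤ
  | .inl a => 2 * B.col a
  | .inr c => 2 * B.col (B.r c) + 1

theorem level_mem (B : BoundarySubdivision G) (x : P ⊕ Q) : 0 ≤ B.level x ∧ B.level x < 6 := by
  rcases x with a | c
  · have := B.col_nonneg a; have := B.col_lt a; simp only [level]; omega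
  · have := B.col_nonneg (B.r c); have := B.col_lt (B.r c); simp only [level]; omega

theorem level_ne (B : BoundarySubdivision G) {x y : P ⊕ Q} (h : G.Adj x y) :
    B.level x ≠ B.level y := by
  rcases x with a | c <;> rcases y with b | d
  · have := B.col_ne a b h
    simp only [level]; omega
  · simp only [level]; omega
  · simp only [level]; omega
  · exact absurd h (B.not_adj_cell c d)

theorem adj_of_mem_cell (B : BoundarySubdivision G) {c : Q} {a b : P}
    (ha : G.Adj (.inr c) (.inl a)) (hb : G.Adj (.inr c) (.inl b)) (hab : a ≠ b) :
    G.Adj (.inl a) (.inl b) := by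
  have h1 := B.adj_pq c
  have h2 := B.adj_pr c
  have h3 := B.adj_qr c
  rw [B.adj_cell] at ha hb
  rcases ha with rfl | rfl | rfl <;> rcases hb with rfl | rfl | rfl <;>
    first | exact absurd rfl hab | assumption | (apply SimpleGraph.Adj.symm; assumption)

/-- Separation starting from a coloured vertex. -/
theorem isSeparated_inl (B : BoundarySubdivision G) (a : P) (v : P ⊕ Q)
    (hne : v ≠ .inl a) (hn : ¬ G.Adj (.inl a) v)
    (h0 : 0 < offset (B.level (.inl a)) (B.level v))
    (h3 : offset (B.level (.inl a)) (B.level v) ≤ 3)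
    (hr : ∀ c, v = .inr c → offset (B.level (.inl a)) (B.level v) = 3 →
      ¬ G.Adj (.inl a) (.inl (B.r c))) :
    IsSeparated G B.level (.inl a) v := by
  have ha0 := B.col_nonneg a
  have ha3 := B.col_lt a
  -- The core is the closed neighbourhood of `a`. With `v` at offset at most 3, a neighbour with a
  -- later neighbour before `v` is an added vertex at offset 1, whose cell contains `a`. An edge
  -- from a coloured neighbour of `a` to `v` requires offsets 2 and 3, the case excluded by `hr`.
  refine isSeparated_of_core (B.level (.inl a)) (B.level_mem _)
    {x | x = .inl a ∨ G.Adj (.inl a) x} (Or.inl rfl) (fun h => h.elim hne hn) ?_ ?_ ?_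
  · simp only [offset] at h0 ⊢; omega
  · rintro x (rfl | hx) y hxy h1 h2
    · exact Or.inr hxy
    · have hl := B.level_ne hx
      have hlx := B.level_mem x
      rcases x with b | c
      · simp only [level, offset] at h1 h2 h3 hl hlx
        rcases y with b' | d <;> rcases v with b'' | d' <;> simp only at h1 h2 h3 <;> omega
      · rcases y with b | d
        · by_cases hab : a = b
          · exact Or.inl (by rw [hab])
          · exact Or.inr (B.adj_of_mem_cell hx.symm hxy hab)
        · exact absurd hxy (B.not_adj_cell c d)
  · rintro x (rfl | hx) hxv h1
    · exact hn hxv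
    · have hl := B.level_ne hx
      rcases x with b | c
      · rcases v with b' | d
        · have := B.col_lt b; have := B.col_nonneg b
          simp only [level, offset] at h1 h3 hl
          omega
        · have hb := (B.adj_cell d b).1 hxv.symm
          have := B.col_p d; have := B.col_q d
          have := B.col_lt b; have := B.col_nonneg b
          have := B.col_lt (B.r d); have := B.col_nonneg (B.r d)
          simp only [level, offset] at h1 h3 hl hr
          rcases hb with rfl | rfl | rfl
          · omega
          · omega
          · exact hr d rfl (by omega) hx
      · rcases v with b | d
        · by_cases hab : a = b
          · exact hne (by rw [hab])
          · exact hn (B.adj_of_mem_cell hx.symm hxv hab)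
        · exact B.not_adj_cell c d hxv

/-- Separation starting from an added vertex. -/
theorem isSeparated_inr (B : BoundarySubdivision G) (c : Q) (v : P ⊕ Q)
    (hn : ¬ G.Adj (.inr c) v)
    (h0 : 0 < offset (B.level (.inr c)) (B.level v))
    (h4 : offset (B.level (.inr c)) (B.level v) ≤ 4)
    (hp : ¬ G.Adj (.inl (B.p c)) v)
    (hr : ∀ d, v = .inr d → offset (B.level (.inr c)) (B.level v) = 4 →
      ¬ G.Adj (.inl (B.p c)) (.inl (B.r d))) :
    IsSeparated G B.level (.inr c) v := by
  have hc0 := B.col_nonneg (B.r c)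
  have hc3 := B.col_lt (B.r c)
  have hp0 := B.col_nonneg (B.p c)
  have hp3 := B.col_lt (B.p c)
  have hcp := B.col_p c
  have hcq := B.col_q c
  have hpc : G.Adj (.inr c) (.inl (B.p c)) := (B.adj_cell _ _).2 (Or.inl rfl)
  -- Seen from `c`, the vertices `p c`, `q c`, `r c` have offsets 1, 3, 5. The core contains `c`, `p
  -- c` and the neighbours of `p c` after it. A coloured one before `v` has offset 3, so it could
  -- only reach `v` at offset 4, as `r` of an added vertex; `hr` forbids this.
  refine isSeparated_of_core (B.level (.inr c)) (B.level_mem _)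
    {x | x = .inr c ∨ x = .inl (B.p c) ∨
      G.Adj (.inl (B.p c)) x ∧ 2 ≤ offset (B.level (.inr c)) (B.level x)}
    (Or.inl rfl) ?_ ?_ ?_ ?_
  · rintro (rfl | rfl | h)
    · simp [offset] at h0
    · exact hn hpc
    · exact hp h.1
  · simp only [offset] at h0 ⊢; omega
  · rintro x (rfl | rfl | ⟨hx, hx2⟩) y hxy h1 h2
    · rcases y with b | d
      · rcases (B.adj_cell c b).1 hxy with rfl | rfl | rfl
        · exact Or.inr (Or.inl rfl)
        · refine Or.inr (Or.inr ⟨B.adj_pq c, ?_⟩)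
          have := B.col_lt (B.q c); have := B.col_nonneg (B.q c)
          simp only [level, offset]; omega
        · refine Or.inr (Or.inr ⟨B.adj_pr c, ?_⟩)
          simp only [level, offset]; omega
      · exact absurd hxy (B.not_adj_cell c d)
    · refine Or.inr (Or.inr ⟨hxy, ?_⟩)
      simp only [level, offset] at h1 ⊢; omega
    · rcases x with b | d
      · have hl := B.level_ne hx
        have := B.col_lt b; have := B.col_nonneg b
        simp only [level, offset] at h1 h2 h4 hl hx2
        omega
      · rcases y with b | d'
        · by_cases hab : B.p c = b
          · exact Or.inr (Or.inl (by rw [hab]))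
          · exact Or.inr (Or.inr ⟨B.adj_of_mem_cell hx.symm hxy hab, by omega⟩)
        · exact absurd hxy (B.not_adj_cell d d')
  · rintro x (rfl | rfl | ⟨hx, hx2⟩) hxv h1
    · exact hn hxv
    · exact hp hxv
    · rcases x with b | d
      · have hl := B.level_ne hx
        have := B.col_lt b; have := B.col_nonneg b
        rcases v with b' | d
        · have := B.col_lt b'; have := B.col_nonneg b'
          simp only [level, offset] at h1 h4 hl hx2
          omega
        · have hb := (B.adj_cell d b).1 hxv.symm
          have := B.col_p d; have := B.col_q d
          have := B.col_lt (B.r d); have := B.col_nonneg (B.r d)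
          simp only [level, offset] at h1 h4 hl hx2 hr
          rcases hb with rfl | rfl | rfl
          · omega
          · omega
          · exact hr d rfl (by omega) hx
      · rcases v with b | d'
        · by_cases hab : B.p c = b
          · exact hn (by rw [← hab]; exact hpc)
          · exact hp (B.adj_of_mem_cell hx.symm hxv hab)
        · exact B.not_adj_cell d d' hxv

/-- Here `p c` and `r d` have equal colours. If they differ, `p c` is not in the cell of `d`, and
one can start from `c`. If they coincide, the directed edges of `c` and `d` are consecutive, and
inducedness of the path permits starting from `d`. -/
theorem isSeparated_inr_inr (B : BoundarySubdivision G) (c d : Q)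
    (h : offset (B.level (.inr c)) (B.level (.inr d)) = 2) :
    IsSeparated G B.level (.inr c) (.inr d) ∨ IsSeparated G B.level (.inr d) (.inr c) := by
  have hpc := B.col_p c
  have hqc := B.col_q c
  have hpd := B.col_p d
  have hqd := B.col_q d
  have := B.col_lt (B.r c); have := B.col_nonneg (B.r c)
  have := B.col_lt (B.r d); have := B.col_nonneg (B.r d)
  by_cases hcd : B.p c = B.r d
  · refine Or.inr (B.isSeparated_inr d (.inr c) (B.not_adj_cell d c) ?_ ?_ ?_ ?_)
    · simp only [level, offset] at h ⊢; omega
    · simp only [level, offset] at h ⊢; omega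
    · intro hadj
      rcases (B.adj_cell c _).1 hadj.symm with e | e | e
      · exact (B.adj_pr d).ne (by rw [e, hcd])
      · exact B.induced d c hcd (e ▸ (B.adj_qr c).symm)
      · rw [e] at hpd; simp only [level, offset] at h; omega
    · rintro _ ⟨⟩ - hadj
      exact B.induced d c hcd hadj.symm
  · refine Or.inl (B.isSeparated_inr c (.inr d) (B.not_adj_cell c d) (by omega) (by omega) ?_ ?_)
    · intro hadj
      rcases (B.adj_cell d _).1 hadj.symm with e | e | e
      · rw [e] at hpc; simp only [level, offset] at h; omega
      · rw [e] at hpc; simp only [level, offset] at h; omega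
      · exact hcd e
    · intros; omega

/-- Offsets 1, 3, 5 mean that `a` has the colour of `p c`, `q c`, `r c`. Only the middle case is
delicate: if `a` is adjacent to `p c`, one starts from `a`, which is not adjacent to `r c` because
the edge from `r c` to `p c` lies in just one triangle. -/
theorem isSeparated_inr_inl (B : BoundarySubdivision G) (c : Q) (a : P)
    (hn : ¬ G.Adj (.inr c) (.inl a)) :
    IsSeparated G B.level (.inr c) (.inl a) ∨ IsSeparated G B.level (.inl a) (.inr c) := by
  have hpc := B.col_p c
  have hqc := B.col_q c
  have := B.col_lt (B.r c); have := B.col_nonneg (B.r c)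
  have := B.col_lt a; have := B.col_nonneg a
  have hcases : offset (B.level (.inr c)) (B.level (.inl a)) = 1 ∨
      offset (B.level (.inr c)) (B.level (.inl a)) = 3 ∨
      offset (B.level (.inr c)) (B.level (.inl a)) = 5 := by
    simp only [level, offset]; omega
  rcases hcases with h | h | h
  · refine Or.inl (B.isSeparated_inr c _ hn (by omega) (by omega) ?_ (by simp))
    intro hadj
    have := B.col_ne _ _ hadj
    have := B.col_lt (B.p c); have := B.col_nonneg (B.p c)
    simp only [level, offset] at h; omega
  · by_cases hadj : G.Adj (.inl (B.p c)) (.inl a)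
    · refine Or.inr (B.isSeparated_inl a (.inr c) (by simp) (fun h => hn h.symm) ?_ ?_ ?_)
      · simp only [level, offset] at h ⊢; omega
      · simp only [level, offset] at h ⊢; omega
      · rintro _ ⟨⟩ - hadj'
        exact hn ((B.adj_cell c a).2 (Or.inr (Or.inl (B.eq_q c a hadj.symm hadj'))))
    · exact Or.inl (B.isSeparated_inr c _ hn (by omega) (by omega) hadj (by simp))
  · refine Or.inr (B.isSeparated_inl a (.inr c) (by simp) (fun h => hn h.symm) ?_ ?_ ?_)
    · simp only [level, offset] at h ⊢; omega
    · simp only [level, offset] at h ⊢; omega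
    · intro _ _ h'
      simp only [level, offset] at h h'; omega

theorem wordRepresentable [Finite P] [Finite Q] (B : BoundarySubdivision G) :
    WordRepresentable G := by
  refine wordRepresentable_of_isSeparated G B.level B.level_mem (fun _ _ h => B.level_ne h) ?_
  rintro (a | c) (b | d) hne hn hl
  · have := B.col_lt a; have := B.col_nonneg a
    have := B.col_lt b; have := B.col_nonneg b
    have hcases : offset (B.level (.inl a)) (B.level (.inl b)) = 2 ∨
        offset (B.level (.inl b)) (B.level (.inl a)) = 2 := by
      simp only [level, offset] at hl ⊢; omega
    rcases hcases with h | h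
    · exact Or.inl (B.isSeparated_inl a _ hne.symm hn (by omega) (by omega) (by simp))
    · exact Or.inr (B.isSeparated_inl b _ hne (fun h => hn h.symm) (by omega) (by omega) (by simp))
  · exact (B.isSeparated_inr_inl d a fun h => hn h.symm).symm
  · exact B.isSeparated_inr_inl c b hn
  · have := B.col_lt (B.r c); have := B.col_nonneg (B.r c)
    have := B.col_lt (B.r d); have := B.col_nonneg (B.r d)
    have hcases : offset (B.level (.inr c)) (B.level (.inr d)) = 2 ∨
        offset (B.level (.inr d)) (B.level (.inr c)) = 2 := by
      simp only [level, offset] at hl ⊢; omega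
    rcases hcases with h | h
    · exact B.isSeparated_inr_inr c d h
    · exact (B.isSeparated_inr_inr d c h).symm

end BoundarySubdivision

/-! ### Subdivided interior cells -/

theorem triangularTiling_adj_iff (u v : ℤ × ℤ) : triangularTiling.Adj u v ↔
    (u.1 - v.1 = 1 ∧ u.2 - v.2 = 0) ∨ (u.1 - v.1 = -1 ∧ u.2 - v.2 = 0) ∨
    (u.1 - v.1 = 0 ∧ u.2 - v.2 = 1) ∨ (u.1 - v.1 = 0 ∧ u.2 - v.2 = -1) ∨
    (u.1 - v.1 = 1 ∧ u.2 - v.2 = -1) ∨ (u.1 - v.1 = -1 ∧ u.2 - v.2 = 1) := by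
  change (u.1 - v.1) ^ 2 + (u.1 - v.1) * (u.2 - v.2) + (u.2 - v.2) ^ 2 = 1 ↔ _
  generalize u.1 - v.1 = a
  generalize u.2 - v.2 = b
  constructor
  · intro h
    have ha1 : a ≤ 1 := by nlinarith [sq_nonneg (a + 2 * b)]
    have ha2 : -1 ≤ a := by nlinarith [sq_nonneg (a + 2 * b)]
    have hb1 : b ≤ 1 := by nlinarith [sq_nonneg (2 * a + b)]
    have hb2 : -1 ≤ b := by nlinarith [sq_nonneg (2 * a + b)]
    interval_cases a <;> interval_cases b <;> simp_all
  · rintro (⟨rfl, rfl⟩ | ⟨rfl, rfl⟩ | ⟨rfl, rfl⟩ | ⟨rfl, rfl⟩ | ⟨rfl, rfl⟩ | ⟨rfl, rfl⟩) <;> norm_num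

theorem mem_cells_of_mem_interiorCells {G : triangularTiling.Subgraph} {c d : Cell}
    (hc : c ∈ interiorCells G) {u v : ℤ × ℤ} (huv : u ≠ v) (hu : u ∈ c.verts) (hv : v ∈ c.verts)
    (hu' : u ∈ d.verts) (hv' : v ∈ d.verts) : d ∈ cells G := by
  by_contra hd
  exact hc.2 ⟨hc.1, u, hu, v, hv, hc.1 u hu v hv huv, d, hd, hu', hv'⟩

/-- The vertices `u, v, w` are meant as the apices across the three edges of `c`. Non-adjacency is
assumed in the whole tiling and passes to the subgraph `G`. -/
theorem not_wordRepresentable_subdivision_of_adj {G : triangularTiling.Subgraph} {S : Set Cell}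
    {c : Cell} (hc : c ∈ S) {x y z u v w : ℤ × ℤ} (hverts : c.verts = {x, y, z})
    (hxy : G.Adj x y) (hxz : G.Adj x z) (hyz : G.Adj y z)
    (huy : G.Adj u y) (huz : G.Adj u z) (hvx : G.Adj v x) (hvz : G.Adj v z)
    (hwx : G.Adj w x) (hwy : G.Adj w y)
    (hux : u ≠ x) (hvy : v ≠ y) (hwz : w ≠ z)
    (hux' : ¬ triangularTiling.Adj u x) (hvy' : ¬ triangularTiling.Adj v y)
    (hwz' : ¬ triangularTiling.Adj w z) :
    ¬ WordRepresentable (subdivision G S) := by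
  have hx : x ∈ c.verts := by simp [hverts]
  have hy : y ∈ c.verts := by simp [hverts]
  have hz : z ∈ c.verts := by simp [hverts]
  have hu : u ∉ c.verts := by simp [hverts, hux, huy.ne, huz.ne]
  have hv : v ∉ c.verts := by simp [hverts, hvy, hvx.ne, hvz.ne]
  have hw : w ∉ c.verts := by simp [hverts, hwz, hwx.ne, hwy.ne]
  exact not_wordRepresentable_of_clique (subdivision G S) (d := .inr ⟨c, hc⟩)
    (x := .inl ⟨x, G.edge_vert hxy⟩) (y := .inl ⟨y, G.edge_vert hyz⟩)
    (z := .inl ⟨z, G.edge_vert hyz.symm⟩) (a := .inl ⟨u, G.edge_vert huy⟩)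
    (b := .inl ⟨v, G.edge_vert hvx⟩) (c := .inl ⟨w, G.edge_vert hwx⟩)
    hx hy hz hxy hxz hyz huy huz hvx hvz hwx hwy hu hv hw
    (fun h => hux' (G.adj_sub h)) (fun h => hvy' (G.adj_sub h)) (fun h => hwz' (G.adj_sub h))
    (by simp) (by simp) (by simp) (by simpa using hux) (by simpa using hvy) (by simpa using hwz)

/-- A subdivision in which some interior cell is subdivided is not word-representable. -/
theorem not_wordRepresentable_subdivision {G : triangularTiling.Subgraph} {S : Set Cell}
    {c : Cell} (hcS : c ∈ S) (hc : c ∈ interiorCells G) :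
    ¬ WordRepresentable (subdivision G S) := by
  have hc' := hc.1
  obtain ⟨x, y, _ | _⟩ := c
  · have h1 : ((x, y, true) : Cell) ∈ cells G := mem_cells_of_mem_interiorCells hc
      (u := (x + 1, y)) (v := (x, y + 1)) (by simp) (by simp [Cell.verts]) (by simp [Cell.verts])
      (by simp [Cell.verts]) (by simp [Cell.verts])
    have h2 : ((x, y + 1, true) : Cell) ∈ cells G := mem_cells_of_mem_interiorCells hc
      (u := (x + 1, y + 1)) (v := (x, y + 1)) (by simp) (by simp [Cell.verts])
      (by simp [Cell.verts]) (by simp [Cell.verts]) (by simp [Cell.verts])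
    have h3 : ((x + 1, y, true) : Cell) ∈ cells G := mem_cells_of_mem_interiorCells hc
      (u := (x + 1, y + 1)) (v := (x + 1, y)) (by simp) (by simp [Cell.verts])
      (by simp [Cell.verts]) (by simp [Cell.verts]) (by simp [Cell.verts])
    refine not_wordRepresentable_subdivision_of_adj hcS (x := (x + 1, y + 1)) (y := (x + 1, y))
      (z := (x, y + 1)) (u := (x, y)) (v := (x, y + 1 + 1)) (w := (x + 1 + 1, y)) rfl
      (hc' _ ?_ _ ?_ ?_) (hc' _ ?_ _ ?_ ?_) (hc' _ ?_ _ ?_ ?_)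
      (h1 _ ?_ _ ?_ ?_) (h1 _ ?_ _ ?_ ?_) (h2 _ ?_ _ ?_ ?_) (h2 _ ?_ _ ?_ ?_)
      (h3 _ ?_ _ ?_ ?_) (h3 _ ?_ _ ?_ ?_) ?_ ?_ ?_ ?_ ?_ ?_ <;>
    first
      | simp [Cell.verts]
      | (simp only [triangularTiling_adj_iff]; omega)
  · have h1 : ((x, y, false) : Cell) ∈ cells G := mem_cells_of_mem_interiorCells hc
      (u := (x + 1, y)) (v := (x, y + 1)) (by simp) (by simp [Cell.verts]) (by simp [Cell.verts])
      (by simp [Cell.verts]) (by simp [Cell.verts])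
    have h2 : ((x - 1, y, false) : Cell) ∈ cells G := mem_cells_of_mem_interiorCells hc
      (u := (x, y)) (v := (x, y + 1)) (by simp) (by simp [Cell.verts])
      (by simp [Cell.verts]) (by simp [Cell.verts]) (by simp [Cell.verts])
    have h3 : ((x, y - 1, false) : Cell) ∈ cells G := mem_cells_of_mem_interiorCells hc
      (u := (x, y)) (v := (x + 1, y)) (by simp) (by simp [Cell.verts])
      (by simp [Cell.verts]) (by simp [Cell.verts]) (by simp [Cell.verts])
    refine not_wordRepresentable_subdivision_of_adj hcS (x := (x, y)) (y := (x + 1, y))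
      (z := (x, y + 1)) (u := (x + 1, y + 1)) (v := (x - 1, y + 1)) (w := (x + 1, y - 1)) rfl
      (hc' _ ?_ _ ?_ ?_) (hc' _ ?_ _ ?_ ?_) (hc' _ ?_ _ ?_ ?_)
      (h1 _ ?_ _ ?_ ?_) (h1 _ ?_ _ ?_ ?_) (h2 _ ?_ _ ?_ ?_) (h2 _ ?_ _ ?_ ?_)
      (h3 _ ?_ _ ?_ ?_) (h3 _ ?_ _ ?_ ?_) ?_ ?_ ?_ ?_ ?_ ?_ <;>
    first
      | simp [Cell.verts]
      | (simp only [triangularTiling_adj_iff]; omega)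

/-! ### The boundary of the triangle -/

theorem mem_verts_T {n : ℕ} {v : ℤ × ℤ} (h : v ∈ (T n).verts) :
    0 ≤ v.1 ∧ 0 ≤ v.2 ∧ v.1 + v.2 ≤ n := by
  obtain ⟨c, hc, hv⟩ := h
  exact hc v hv

theorem mem_cells_T {n : ℕ} {c : Cell} : c ∈ cells (T n) ↔ c ∈ triangleCells n := by
  constructor
  · intro hc u hu
    obtain ⟨v, hv, huv⟩ : ∃ v ∈ c.verts, u ≠ v := by
      obtain ⟨x, y, _ | _⟩ := c <;>
      simp only [Cell.verts, Finset.mem_insert, Finset.mem_singleton] at hu <;>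
      rcases hu with rfl | rfl | rfl <;> simp [Cell.verts]
    exact mem_verts_T ((T n).edge_vert (hc u hu v hv huv))
  · intro hc u hu v hv huv
    exact ⟨huv, c, hc, hu, hv⟩

theorem mem_verts_T_of_mem_cell {n : ℕ} {c : Cell} (hc : c ∈ cells (T n)) {v : ℤ × ℤ}
    (hv : v ∈ c.verts) : v ∈ (T n).verts :=
  ⟨c, mem_cells_T.1 hc, hv⟩

/-- The three neighbours of a downward cell in the triangle are upward cells that also lie in it, so
a boundary cell must point up and have an edge on a side. -/
theorem boundaryCells_T {n : ℕ} {c : Cell} (hc : c ∈ boundaryCells (T n)) :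
    c.2.2 = true ∧ 0 ≤ c.1 ∧ 0 ≤ c.2.1 ∧ c.1 + c.2.1 + 1 ≤ n ∧
      (c.1 = 0 ∨ c.2.1 = 0 ∨ c.1 + c.2.1 + 1 = n) := by
  obtain ⟨hc, u, hu, v, hv, huv, d, hd, hu', hv'⟩ := hc
  have hne := huv.ne
  rw [mem_cells_T] at hc hd
  obtain ⟨u1, u2⟩ := u
  obtain ⟨v1, v2⟩ := v
  obtain ⟨x, y, _ | _⟩ := c <;> obtain ⟨x', y', _ | _⟩ := d <;>
  simp only [triangleCells, Cell.verts, Set.mem_ofPred_eq, Finset.mem_insert, Finset.mem_singleton,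
    forall_eq_or_imp, forall_eq, Prod.mk.injEq, ne_eq] at hc hd hu hv hu' hv' hne ⊢ <;>
  simp only [true_and, Bool.false_eq_true, false_and] <;> omega

/-- Vertices `r, p, q` of an upward cell touching the boundary of the triangle, where `r` and `p`
are consecutive on the boundary in counterclockwise order. -/
def boundaryFrame (c : Cell) : (ℤ × ℤ) × (ℤ × ℤ) × (ℤ × ℤ) :=
  if c.2.1 = 0 then ((c.1, c.2.1), (c.1 + 1, c.2.1), (c.1, c.2.1 + 1))
  else if c.1 = 0 then ((c.1, c.2.1 + 1), (c.1, c.2.1), (c.1 + 1, c.2.1))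
  else ((c.1 + 1, c.2.1), (c.1, c.2.1 + 1), (c.1, c.2.1))

theorem mem_verts_iff_boundaryFrame {c : Cell} (hc : c.2.2 = true) (v : ℤ × ℤ) :
    v ∈ c.verts ↔
      v = (boundaryFrame c).2.1 ∨ v = (boundaryFrame c).2.2 ∨ v = (boundaryFrame c).1 := by
  obtain ⟨x, y, b⟩ := c
  obtain rfl : b = true := hc
  simp only [Cell.verts, boundaryFrame, Finset.mem_insert, Finset.mem_singleton]
  split_ifs <;> tauto

theorem finite_verts_T (n : ℕ) : (T n).verts.Finite := by
  refine ((Set.finite_Icc (0 : ℤ) n).prod (Set.finite_Icc (0 : ℤ) n)).subset fun v hv => ?_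
  have := mem_verts_T hv
  simp only [Set.mem_prod, Set.mem_Icc]
  omega

theorem finite_boundaryCells_T (n : ℕ) : (boundaryCells (T n)).Finite := by
  refine ((Set.finite_Icc (0 : ℤ) n).prod ((Set.finite_Icc (0 : ℤ) n).prod
    (Set.finite_univ (α := Bool)))).subset fun c hc => ?_
  have := boundaryCells_T hc
  simp only [Set.mem_prod, Set.mem_Icc, Set.mem_univ, and_true]
  omega

/-- The subdivision of all boundary cells of `T n`, with vertex `(x, y)` coloured by `x - y` modulo
three. -/
def boundarySubdivision (n : ℕ) : BoundarySubdivision (A n) :=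
  have mem1 : ∀ c : boundaryCells (T n), (boundaryFrame c).1 ∈ (c : Cell).verts := fun c =>
    (mem_verts_iff_boundaryFrame (boundaryCells_T c.2).1 _).2 (Or.inr (Or.inr rfl))
  have mem2 : ∀ c : boundaryCells (T n), (boundaryFrame c).2.1 ∈ (c : Cell).verts := fun c =>
    (mem_verts_iff_boundaryFrame (boundaryCells_T c.2).1 _).2 (Or.inl rfl)
  have mem3 : ∀ c : boundaryCells (T n), (boundaryFrame c).2.2 ∈ (c : Cell).verts := fun c =>
    (mem_verts_iff_boundaryFrame (boundaryCells_T c.2).1 _).2 (Or.inr (Or.inl rfl))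
  -- The counterclockwise boundary steps `(1, 0)`, `(-1, 1)`, `(0, -1)` all change `x - y` by 1
  -- modulo three.
  { col := fun v => ((v : ℤ × ℤ).1 - (v : ℤ × ℤ).2) % 3
    p := fun c => ⟨(boundaryFrame c).2.1, mem_verts_T_of_mem_cell c.2.1 (mem2 c)⟩
    q := fun c => ⟨(boundaryFrame c).2.2, mem_verts_T_of_mem_cell c.2.1 (mem3 c)⟩
    r := fun c => ⟨(boundaryFrame c).1, mem_verts_T_of_mem_cell c.2.1 (mem1 c)⟩
    col_nonneg := fun a => by omega
    col_lt := fun a => by omega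
    col_ne := fun a b h => by
      have := (triangularTiling_adj_iff _ _).1 ((T n).adj_sub h)
      omega
    adj_cell := fun c a => by
      simp only [Subtype.ext_iff]
      exact mem_verts_iff_boundaryFrame (boundaryCells_T c.2).1 a
    not_adj_cell := fun c d h => h
    col_p := fun c => by
      simp only [boundaryFrame]
      split_ifs <;> simp only <;> omega
    col_q := fun c => by
      simp only [boundaryFrame]
      split_ifs <;> simp only <;> omega
    adj_pq := fun c => c.2.1 _ (mem2 c) _ (mem3 c) (by
      simp only [boundaryFrame]
      split_ifs <;> simp)
    adj_pr := fun c => c.2.1 _ (mem2 c) _ (mem1 c) (by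
      simp only [boundaryFrame]
      split_ifs <;> simp)
    adj_qr := fun c => c.2.1 _ (mem3 c) _ (mem1 c) (by
      simp only [boundaryFrame]
      split_ifs <;> simp)
    -- The other common neighbour of `r c` and `p c` in the tiling lies outside the triangle.
    eq_q := fun c a hp hr => by
      have ha := mem_verts_T a.2
      have hc := boundaryCells_T c.2
      have hp := (triangularTiling_adj_iff _ _).1 ((T n).adj_sub hp)
      have hr := (triangularTiling_adj_iff _ _).1 ((T n).adj_sub hr)
      rw [Subtype.ext_iff, Prod.ext_iff]
      simp only [boundaryFrame] at hp hr ⊢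
      split_ifs at hp hr ⊢ <;> simp only at hp hr ⊢ <;> omega
    -- Two consecutive edges on one side have non-adjacent outer ends. At a corner the ends would be
    -- adjacent, but both edges there belong to the same cell, and `boundaryFrame` selects only one
    -- of them.
    induced := fun c d h hadj => by
      have hc := boundaryCells_T c.2
      have hd := boundaryCells_T d.2
      have hadj := (triangularTiling_adj_iff _ _).1 ((T n).adj_sub hadj)
      rw [Subtype.ext_iff, Prod.ext_iff] at h
      simp only [boundaryFrame] at h hadj
      split_ifs at h hadj <;> simp only at h hadj <;> omega }

theorem wordRepresentable_A (n : ℕ) : WordRepresentable (A n) :=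
  have : Finite (T n).verts := finite_verts_T n
  have : Finite (boundaryCells (T n)) := finite_boundaryCells_T n
  (boundarySubdivision n).wordRepresentable

/-! ### Maximum subdivisions -/

theorem WordRepresentable.subdivision_mono {G : triangularTiling.Subgraph} {S S' : Set Cell}
    (h : WordRepresentable (subdivision G S')) (hS : S ⊆ S') :
    WordRepresentable (subdivision G S) := by
  convert h.comap ((Function.Embedding.refl _).sumMap (Set.embeddingOfSubset S S' hS)) using 1
  ext (a | c) (b | d) <;> rfl

/-- If subdividing all boundary cells gives a word-representable graph, then this is the maximum
subdivision. -/
theorem isMaximumSubdivision_boundaryCells {G : triangularTiling.Subgraph}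
    (h : WordRepresentable (subdivision G (boundaryCells G))) :
    IsMaximumSubdivision G (boundaryCells G) := by
  refine ⟨⟨fun c hc => hc.1, h, fun c hc hcb =>
    not_wordRepresentable_subdivision (Set.mem_insert c _) ⟨hc, hcb⟩⟩, ?_⟩
  rintro S ⟨hS, hw, hmax⟩
  have hSb : S ⊆ boundaryCells G := fun c hc => by
    by_contra hcb
    exact not_wordRepresentable_subdivision hc ⟨hS hc, hcb⟩ hw
  refine hSb.antisymm fun c hc => ?_
  by_contra hcS
  -- A boundary cell missing from `S` could be added to `S` without leaving the set of boundary
  -- cells, against maximality.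
  exact hmax c hc.1 hcS (h.subdivision_mono (Set.insert_subset hc hSb))

end TriGrid

theorem mainTheorem4 (n : ℕ) :
    (∀ S : Set TriGrid.Cell, S ⊆ TriGrid.cells (TriGrid.T n) →
      (∃ c ∈ S, c ∈ TriGrid.interiorCells (TriGrid.T n)) →
        ¬ TriGrid.WordRepresentable (TriGrid.subdivision (TriGrid.T n) S)) ∧
    TriGrid.WordRepresentable (TriGrid.A n) ∧
    TriGrid.IsMaximumSubdivision (TriGrid.T n) (TriGrid.boundaryCells (TriGrid.T n)) :=
  ⟨fun _ _ ⟨_, hcS, hc⟩ => TriGrid.not_wordRepresentable_subdivision hcS hc,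
    TriGrid.wordRepresentable_A n,
    TriGrid.isMaximumSubdivision_boundaryCells (TriGrid.wordRepresentable_A n)⟩
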